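/- **Theorem.** For integers $A>0$ and $i\ge 0$ let $C_0=[0,1]^2$ (one square), and let $C_{i+1}$ be obtained from $C_i$ by cutting each of its squares into $A\times A$ equal closed subsquares and removing the central $(A-2)\times(A-2)$ block of them. Let $B_i=A^iC_i\subset\mathbb R^2$, a union of closed unit squares, so that $B_i\times B_i\subset\mathbb R^4$ is a union of closed unit $4$-cubes (products of two squares of $B_i$). A code with bits (or qubits) and checks has a *local embedding* with constants $(r,\rho)$ to a region $B\subseteq\mathbb R^D$ if there is a map from the set of its bits and checks to $B$ such that each check is mapped within Euclidean distance $r$ of every bit it interacts with, and every closed unit ball of $\mathbb R^D$ contains the images of at most $\rho$ bits and checks. For a classical code with parity-check matrix $H$, a check interacts with a bit when the corresponding entry of $H$ is nonzero; for a quantum CSS code $(H_x,H_z)$, the rows of both matrices are the checks. There is an integer $A_0$ such that for every integer $A\ge A_0$ the following hold. 1. There are constants $K$ and $N$, depending only on $A$, such that for every $i\ge 0$ there is a map $f_i:B_i\times B_i\to\mathbb R^3$ with - (bounded distances) $|f_i(x)-f_i(y)|\le K|x-y|$ for all $x,y\in B_i\times B_i$; - (bounded density) for every closed unit ball in $\mathbb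 R^3$, at most $N$ of the unit $4$-cubes of $B_i\times B_i$ have an image under $f_i$ that meets the ball. 2. For all $r$ and $\rho$ there are constants $r'$ and $\rho'$, depending only on $A,r,\rho$, such that for every $i\ge 0$, every field $F$ (in particular every $\mathbb F_q$), and every two classical codes $H_1:F^{n_1}\to F^{n_1'}$, $H_2:F^{n_2}\to F^{n_2'}$ that have local embeddings to $B_i$ with constants $(r,\rho)$, their hypergraph product, i.e. the CSS code given by the tensor product complex $$F^{n_1}\otimes F^{n_2}\xrightarrow{\ \delta_0=H_z^T\ }(F^{n_1}\otimes F^{n_2'})\oplus(F^{n_1'}\otimes F^{n_2})\xrightarrow{\ \delta_1=H_x\ }F^{n_1'}\otimes F^{n_2'},$$ $$\delta_0(u)=\big((1\otimes H_2)u,\ (H_1\otimes 1)u\big),\qquad \delta_1(v,w)=(H_1\otimes 1)v-(1\otimes H_2)w,$$ has a local embedding to $\mathbb R^3$ with constants $(r',\rho')$. That is, these hypergraph products are 3D local quantum codes. -/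

import Mathlib

open scoped Pointwise Kronecker

namespace CarpetCodes

/-- The Euclidean plane. -/
abbrev Plane : Type := EuclideanSpace ℝ (Fin 2)

/-- Euclidean `ℝ² × ℝ² = ℝ⁴` (with the `ℓ²` product metric). -/
abbrev PlaneSq : Type := WithLp 2 (Plane × Plane)

/-- Euclidean `3`-space. -/
abbrev Space : Type := EuclideanSpace ℝ (Fin 3)

/-! ## The carpet and its prefractals -/

/-- The positions `(s, t)` of an `A × A` grid which are outside the central
`(A - 2) × (A - 2)` block, that is, outside `{1, …, A - 2} × {1, …, A - 2}`. -/
def ringPositions (A : ℕ) : Finset (ℕ × ℕ) :=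
  (Finset.range A ×ˢ Finset.range A).filter
    fun p => ¬ ((1 ≤ p.1 ∧ p.1 + 2 ≤ A) ∧ (1 ≤ p.2 ∧ p.2 + 2 ≤ A))

/-- The squares of the `i`-th prefractal. The pair `(a, b)` stands for the square of
side `A⁻ⁱ` with lower left corner `(a / Aⁱ, b / Aⁱ)`. Cutting it into `A × A` subsquares
gives the squares `(A a + s, A b + t)` of side `A⁻⁽ⁱ⁺¹⁾` with `0 ≤ s, t < A`. -/
def carpetCells (A : ℕ) : ℕ → Finset (ℕ × ℕ)
  | 0 => {(0, 0)}
  | i + 1 => (carpetCells A i ×ˢ ringPositions A).image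
      fun p => (A * p.1.1 + p.2.1, A * p.1.2 + p.2.2)

/-- The closed square of side `ℓ` with lower left corner `(ℓ a, ℓ b)`. -/
def square (ℓ : ℝ) (c : ℕ × ℕ) : Set Plane :=
  {x | (ℓ * c.1 ≤ x 0 ∧ x 0 ≤ ℓ * (c.1 + 1)) ∧ (ℓ * c.2 ≤ x 1 ∧ x 1 ≤ ℓ * (c.2 + 1))}

/-- The `i`-th prefractal `C_i ⊆ [0, 1]²`. -/
def prefractal (A i : ℕ) : Set Plane :=
  ⋃ c ∈ carpetCells A i, square ((A : ℝ) ^ i)⁻¹ c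

/-- The rescaled prefractal `B_i = Aⁱ C_i`, in which every square has side `1`. -/
def scaledPrefractal (A i : ℕ) : Set Plane :=
  ((A : ℝ) ^ i) • prefractal A i

/-- The squares of `B_i` are unit squares. -/
theorem scaledPrefractal_eq (A i : ℕ) (hA : A ≠ 0) :
    scaledPrefractal A i = ⋃ c ∈ carpetCells A i, square 1 c := by
  have h : (0 : ℝ) < (A : ℝ) ^ i := by positivity
  ext x
  simp only [scaledPrefractal, prefractal, Set.mem_smul_set_iff_inv_smul_mem₀ h.ne',
    Set.mem_iUnion, square, Set.mem_ofPred_eq, PiLp.smul_apply, smul_eq_mul,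
    mul_le_mul_iff_right₀ (inv_pos.2 h), one_mul]

/-- The product `B_i × B_i ⊆ ℝ⁴`. -/
def prefractalSq (A i : ℕ) : Set PlaneSq :=
  {x | x.fst ∈ scaledPrefractal A i ∧ x.snd ∈ scaledPrefractal A i}

/-- The product of two unit squares, a unit `4`-cube. -/
def cube (c : (ℕ × ℕ) × (ℕ × ℕ)) : Set PlaneSq :=
  {x | x.fst ∈ square 1 c.1 ∧ x.snd ∈ square 1 c.2}

/-- `f` is a local embedding of `B_i × B_i` into `ℝ³` with constants `K` and `N`.
Bounded distances: distances grow at most by the factor `K`. Bounded density: the image of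
at most `N` of the unit cubes of which `B_i × B_i` consists meets a given unit ball. -/
structure IsLocalRegionEmbedding (A i : ℕ) (K : ℝ) (N : ℕ) (f : PlaneSq → Space) : Prop where
  dist_le : ∀ x ∈ prefractalSq A i, ∀ y ∈ prefractalSq A i, dist (f x) (f y) ≤ K * dist x y
  density_le : ∀ z : Space,
    {c | c ∈ carpetCells A i ×ˢ carpetCells A i ∧
      (f '' cube c ∩ Metric.closedBall z 1).Nonempty}.encard ≤ N

/-! ## Codes and their local embeddings -/

/-- A code with bits `β` and checks `κ`, in which the check `k` interacts with the bit `b` when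
`H k b ≠ 0`, has a local embedding to the region `B ⊆ ℝᴰ` with constants `r` and `ρ`:
there is a map of the bits and checks to `B` such that a check is at distance at most `r` from
every bit it interacts with, and a unit ball contains at most `ρ` bits and checks. -/
def HasLocalEmbedding {F β κ : Type*} [Zero F] {D : ℕ} (H : Matrix κ β F)
    (B : Set (EuclideanSpace ℝ (Fin D))) (r : ℝ) (ρ : ℕ) : Prop :=
  ∃ I : β ⊕ κ → EuclideanSpace ℝ (Fin D),
    (∀ s, I s ∈ B) ∧
    (∀ k b, H k b ≠ 0 → dist (I (Sum.inr k)) (I (Sum.inl b)) ≤ r) ∧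
    ∀ z : EuclideanSpace ℝ (Fin D), {s | I s ∈ Metric.closedBall z 1}.encard ≤ ρ

/-- A quantum CSS code with qubits `Q`, `X`-checks `MX` and `Z`-checks `MZ`, given by the
matrices `H_x : F^Q → F^MZ` (the syndrome of `X`-operators is measured by the `Z`-checks) and
`H_z : F^Q → F^MX` with `H_x H_zᵀ = 0`. -/
structure CSSCode (F Q MX MZ : Type*) [Field F] [Fintype Q] where
  Hx : Matrix MZ Q F
  Hz : Matrix MX Q F
  comm : Hx * Hz.transpose = 0

/-- The check matrix of all the `X`-checks and `Z`-checks of a quantum CSS code. -/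
def CSSCode.checks {F Q MX MZ : Type*} [Field F] [Fintype Q] (X : CSSCode F Q MX MZ) :
    Matrix (MX ⊕ MZ) Q F :=
  Matrix.fromRows X.Hz X.Hx

/-- A quantum CSS code is local in `D` dimensions, with constants `r` and `ρ`, when its qubits and
checks have a local embedding to `ℝᴰ`. -/
def CSSCode.IsLocal {F Q MX MZ : Type*} [Field F] [Fintype Q] (X : CSSCode F Q MX MZ)
    (D : ℕ) (r : ℝ) (ρ : ℕ) : Prop :=
  HasLocalEmbedding X.checks (Set.univ : Set (EuclideanSpace ℝ (Fin D))) r ρ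

/-- The hypergraph product of two classical codes `H₁ : F^n₁ → F^n₁'`, `H₂ : F^n₂ → F^n₂'`, that is,
the tensor product complex
`F^n₁ ⊗ F^n₂ → (F^n₁ ⊗ F^n₂') ⊕ (F^n₁' ⊗ F^n₂) → F^n₁' ⊗ F^n₂'`
with `δ₀ = H_zᵀ = (1 ⊗ H₂, H₁ ⊗ 1)` and `δ₁ = H_x = (H₁ ⊗ 1, - 1 ⊗ H₂)`. -/
def hypergraphProduct {F : Type*} [Field F] {n₁ n₁' n₂ n₂' : ℕ}
    (H₁ : Matrix (Fin n₁') (Fin n₁) F) (H₂ : Matrix (Fin n₂') (Fin n₂) F) :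
    CSSCode F ((Fin n₁ × Fin n₂') ⊕ (Fin n₁' × Fin n₂)) (Fin n₁ × Fin n₂) (Fin n₁' × Fin n₂') where
  Hx := Matrix.fromCols (H₁ ⊗ₖ (1 : Matrix (Fin n₂') (Fin n₂') F))
    (-((1 : Matrix (Fin n₁') (Fin n₁') F) ⊗ₖ H₂))
  Hz := (Matrix.fromRows ((1 : Matrix (Fin n₁) (Fin n₁) F) ⊗ₖ H₂)
    (H₁ ⊗ₖ (1 : Matrix (Fin n₂) (Fin n₂) F))).transpose
  comm := by
    rw [Matrix.transpose_transpose, Matrix.fromCols_mul_fromRows, Matrix.neg_mul,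
      ← Matrix.mul_kronecker_mul, ← Matrix.mul_kronecker_mul]
    simp

end CarpetCodes

namespace CarpetCodes

open Finset

/-! The map sends `(x, y)` to `(x₀ + x₁, y₀ + y₁, g (x, y))`. Bounded distances ask that `g` be
Lipschitz. Bounded density asks that `g` separate, up to bounded multiplicity, the cubes whose lower
corners have the same two coordinate sums (a `fiber`). Such a `g` comes from a lattice function `Ψ`
built by induction on `i`, with constants that do not grow.

Write `R = colorRange M`. Given `Ψ` at level `i` with steps at most `4R`, its interpolation at `q /
A` has steps `4R / A`. It still separates cubes well: a diagonal meets the ring in at most 4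
positions modulo `A`, so a fiber at level `i + 1` is spread over 16 pairs of positions, and for each
of them the parent cubes lie in one fiber at level `i`. The multiplicity grows from `N` to at most
`16 N` (`Separates.card_interp_le`).

The small steps leave room to restore `N`. Stretch the interpolation by `A / 16`, round to multiples
of `R`, and add `64 ^ κ q`, where the colouring `κ` distinguishes corners of cubes that the
interpolation fails to separate; these conflicts have degree at most `256 N`. If two cubes of a
fiber take nearly the same new value, their interpolated values are close, so the cubes conflict. If
moreover their rounded values agree at all corners, the interpolated powers of 64 nearly agree, and
a corner that dominates both sums has the same colour in both cubes, a contradiction. So the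
multiplicity is at most the number of patterns of rounded values with a marked corner, independent
of `A`, `M` and `i` (`Separates.refinement`). The constants are therefore chosen in the order `N`,
`M`, `A`.

For the codes, a pair of bits or checks is placed at the image of the pair of their positions. -/

/-! ### Multilinear interpolation on the unit cube -/

/-- Lattice points of `ℤ⁴` with nonnegative coordinates, as pairs of points of the plane. -/
abbrev Grid : Type := (ℕ × ℕ) × (ℕ × ℕ)

/-- The corners of the unit cube at the origin. -/
@[irreducible] def corners : Finset Grid := (range 2 ×ˢ range 2) ×ˢ (range 2 ×ˢ range 2)

theorem card_corners : #corners = 16 := by simp [corners]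

/-- The weight of the endpoint `e ∈ {0, 1}` at the point `t` of the unit interval. -/
def endWeight (t : ℝ) (e : ℕ) : ℝ := if e = 0 then 1 - t else t

/-- The weight of the corner `e` at the point `t` of the unit cube. -/
def cornerWeight (t : (ℝ × ℝ) × (ℝ × ℝ)) (e : Grid) : ℝ :=
  endWeight t.1.1 e.1.1 * (endWeight t.1.2 e.1.2 *
    (endWeight t.2.1 e.2.1 * endWeight t.2.2 e.2.2))

/-- The unit cube. -/
def unitCube : Set ((ℝ × ℝ) × (ℝ × ℝ)) :=
  (Set.Icc 0 1 ×ˢ Set.Icc 0 1) ×ˢ (Set.Icc 0 1 ×ˢ Set.Icc 0 1)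

/-- Multilinear interpolation of values at the corners of the unit cube. -/
def blend (t : (ℝ × ℝ) × (ℝ × ℝ)) (G : Grid → ℝ) : ℝ :=
  ∑ e ∈ corners, cornerWeight t e * G e

theorem endWeight_nonneg {t : ℝ} (ht : t ∈ Set.Icc (0 : ℝ) 1) (e : ℕ) : 0 ≤ endWeight t e := by
  unfold endWeight
  split_ifs
  · linarith [ht.2]
  · exact ht.1

theorem cornerWeight_nonneg {t : (ℝ × ℝ) × (ℝ × ℝ)} (ht : t ∈ unitCube) (e : Grid) :
    0 ≤ cornerWeight t e :=
  mul_nonneg (endWeight_nonneg ht.1.1 _) (mul_nonneg (endWeight_nonneg ht.1.2 _)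
    (mul_nonneg (endWeight_nonneg ht.2.1 _) (endWeight_nonneg ht.2.2 _)))

theorem sum_cornerWeight (t : (ℝ × ℝ) × (ℝ × ℝ)) : ∑ e ∈ corners, cornerWeight t e = 1 := by
  simp only [corners, cornerWeight, endWeight, sum_product, sum_range_succ, range_zero, sum_empty]
  simp
  ring_nf

theorem abs_blend_sub_le {t : (ℝ × ℝ) × (ℝ × ℝ)} (ht : t ∈ unitCube) {G : Grid → ℝ} {x C : ℝ}
    (h : ∀ e ∈ corners, |G e - x| ≤ C) : |blend t G - x| ≤ C := by
  have hx : blend t G - x = ∑ e ∈ corners, cornerWeight t e * (G e - x) := by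
    simp only [mul_sub, sum_sub_distrib, ← sum_mul, sum_cornerWeight, blend, one_mul]
  rw [hx]
  calc _ ≤ ∑ e ∈ corners, |cornerWeight t e * (G e - x)| := abs_sum_le_sum_abs _ _
    _ ≤ ∑ e ∈ corners, cornerWeight t e * C := by
      refine sum_le_sum fun e he => ?_
      rw [abs_mul, abs_of_nonneg (cornerWeight_nonneg ht e)]
      exact mul_le_mul_of_nonneg_left (h e he) (cornerWeight_nonneg ht e)
    _ = C := by rw [← sum_mul, sum_cornerWeight, one_mul]

/-- The largest of the 16 summands is at least their average. It marks the corner at which colours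
are later compared. -/
theorem exists_blend_le (t : (ℝ × ℝ) × (ℝ × ℝ)) (G : Grid → ℝ) :
    ∃ e ∈ corners, blend t G ≤ 16 * (cornerWeight t e * G e) := by
  obtain ⟨e, he, hmax⟩ := exists_max_image corners (fun e => cornerWeight t e * G e)
    (card_pos.1 (by rw [card_corners]; norm_num))
  refine ⟨e, he, ?_⟩
  have := sum_le_card_nsmul corners (fun e => cornerWeight t e * G e) _ hmax
  rw [card_corners, nsmul_eq_mul] at this
  exact_mod_cast this

theorem le_blend {t : (ℝ × ℝ) × (ℝ × ℝ)} (ht : t ∈ unitCube) {G : Grid → ℝ}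
    (hG : ∀ e ∈ corners, 0 ≤ G e) {e : Grid} (he : e ∈ corners) :
    cornerWeight t e * G e ≤ blend t G :=
  single_le_sum (f := fun e => cornerWeight t e * G e)
    (fun e he => mul_nonneg (cornerWeight_nonneg ht e) (hG e he)) he

/-- Linear interpolation, at `m / A`, of a function on the natural numbers. -/
noncomputable def lerp (A m : ℕ) (g : ℕ → ℝ) : ℝ :=
  (1 - ((m % A : ℕ) : ℝ) / A) * g (m / A) + ((m % A : ℕ) : ℝ) / A * g (m / A + 1)

theorem modDiv_mem_Icc (A m : ℕ) : ((m % A : ℕ) : ℝ) / A ∈ Set.Icc (0 : ℝ) 1 := by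
  rcases A.eq_zero_or_pos with rfl | hA
  · simp
  · refine ⟨by positivity, div_le_one_of_le₀ ?_ (by positivity)⟩
    exact_mod_cast (Nat.mod_lt m hA).le

theorem lerp_succ {A : ℕ} (hA : 0 < A) (m : ℕ) (g : ℕ → ℝ) :
    lerp A (m + 1) g - lerp A m g = (g (m / A + 1) - g (m / A)) / A := by
  have hA' : (A : ℝ) ≠ 0 := by positivity
  have h1 := Nat.div_add_mod m A
  have h2 := Nat.mod_lt m hA
  generalize m / A = c at *
  generalize m % A = d at *
  subst h1
  -- If the remainder is `A - 1`, the next point is the left end of the next interval, with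
  -- remainder 0; otherwise both points lie in one interval.
  rcases (Nat.succ_le_of_lt h2).eq_or_lt with h | h
  · have e1 : A * c + d + 1 = A * (c + 1) := by rw [mul_add, mul_one]; omega
    have e2 : (d : ℝ) = A - 1 := by rw [← h]; push_cast; ring
    unfold lerp
    rw [e1, Nat.mul_mod_right, Nat.mul_div_cancel_left _ hA, Nat.mul_add_mod,
      Nat.mod_eq_of_lt h2, Nat.mul_add_div hA, Nat.div_eq_of_lt h2, e2]
    simp
    field_simp
    ring
  · unfold lerp
    rw [add_assoc, Nat.mul_add_mod, Nat.mul_add_mod, Nat.mod_eq_of_lt h2, Nat.mod_eq_of_lt h,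
      Nat.mul_add_div hA, Nat.mul_add_div hA, Nat.div_eq_of_lt h2, Nat.div_eq_of_lt h]
    simp only [Nat.cast_succ, add_zero]
    field_simp
    ring

theorem abs_lerp_sub_lerp_le {A m : ℕ} {g h : ℕ → ℝ} {C : ℝ} (H : ∀ n, |g n - h n| ≤ C) :
    |lerp A m g - lerp A m h| ≤ C := by
  obtain ⟨h0, h1⟩ := modDiv_mem_Icc A m
  have a := abs_le.1 (H (m / A))
  have b := abs_le.1 (H (m / A + 1))
  unfold lerp
  generalize ((m % A : ℕ) : ℝ) / A = t at *
  rw [abs_le]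
  constructor <;> nlinarith

/-! ### Lattice functions with bounded steps and their interpolation -/

/-- The function `Ψ` changes by at most `K` along the edges of the grid. -/
def StepBounded (K : ℝ) (Ψ : Grid → ℝ) : Prop :=
  ∀ a b c d : ℕ,
    (|Ψ ((a + 1, b), (c, d)) - Ψ ((a, b), (c, d))| ≤ K ∧
      |Ψ ((a, b + 1), (c, d)) - Ψ ((a, b), (c, d))| ≤ K) ∧
    (|Ψ ((a, b), (c + 1, d)) - Ψ ((a, b), (c, d))| ≤ K ∧
      |Ψ ((a, b), (c, d + 1)) - Ψ ((a, b), (c, d))| ≤ K)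

theorem abs_sub_le_of_step {g : ℕ → ℝ} {K : ℝ} (h : ∀ n, |g (n + 1) - g n| ≤ K) (m n : ℕ) :
    |g m - g n| ≤ K * |(m : ℝ) - n| := by
  have key : ∀ k n : ℕ, |g (n + k) - g n| ≤ K * k := by
    intro k n
    induction k with
    | zero => simp
    | succ k ih =>
      calc _ = |(g (n + k + 1) - g (n + k)) + (g (n + k) - g n)| := by
            rw [sub_add_sub_cancel, add_assoc]
        _ ≤ K + K * k := (abs_add_le _ _).trans (add_le_add (h _) ih)
        _ = _ := by push_cast; ring
  rcases le_total m n with hmn | hmn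
  · obtain ⟨k, rfl⟩ := Nat.exists_eq_add_of_le hmn
    rw [abs_sub_comm, abs_sub_comm (m : ℝ)]
    simpa using key k m
  · obtain ⟨k, rfl⟩ := Nat.exists_eq_add_of_le hmn
    simpa using key k n

theorem StepBounded.abs_sub_le_l1 {K : ℝ} {Ψ : Grid → ℝ} (h : StepBounded K Ψ) (p q : Grid) :
    |Ψ p - Ψ q| ≤ K * ((|(p.1.1 : ℝ) - q.1.1| + |(p.1.2 : ℝ) - q.1.2|) +
      (|(p.2.1 : ℝ) - q.2.1| + |(p.2.2 : ℝ) - q.2.2|)) := by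
  obtain ⟨⟨a, b⟩, c, d⟩ := p
  obtain ⟨⟨a', b'⟩, c', d'⟩ := q
  have h1 := abs_sub_le_of_step (g := fun n => Ψ ((n, b), (c, d))) (fun n => (h n b c d).1.1) a a'
  have h2 := abs_sub_le_of_step (g := fun n => Ψ ((a', n), (c, d)))
    (fun n => (h a' n c d).1.2) b b'
  have h3 := abs_sub_le_of_step (g := fun n => Ψ ((a', b'), (n, d)))
    (fun n => (h a' b' n d).2.1) c c'
  have h4 := abs_sub_le_of_step (g := fun n => Ψ ((a', b'), (c', n)))
    (fun n => (h a' b' c' n).2.2) d d'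
  have s1 := abs_sub_le (Ψ ((a, b), (c, d))) (Ψ ((a', b), (c, d))) (Ψ ((a', b'), (c', d')))
  have s2 := abs_sub_le (Ψ ((a', b), (c, d))) (Ψ ((a', b'), (c, d))) (Ψ ((a', b'), (c', d')))
  have s3 := abs_sub_le (Ψ ((a', b'), (c, d))) (Ψ ((a', b'), (c', d))) (Ψ ((a', b'), (c', d')))
  simp only at *
  linarith

theorem StepBounded.abs_sub_corner_le {K : ℝ} {Ψ : Grid → ℝ} (h : StepBounded K Ψ) (hK : 0 ≤ K)
    (q : Grid) {e e' : Grid} (he : e ∈ corners) (he' : e' ∈ corners) :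
    |Ψ (q + e) - Ψ (q + e')| ≤ 4 * K := by
  have key : ∀ m a b : ℕ, a < 2 → b < 2 → |((m + a : ℕ) : ℝ) - ((m + b : ℕ) : ℝ)| ≤ 1 := by
    intro m a b ha hb
    interval_cases a <;> interval_cases b <;> simp
  simp only [corners, mem_product, mem_range] at he he'
  have := h.abs_sub_le_l1 (q + e) (q + e')
  have h1 := key q.1.1 _ _ he.1.1 he'.1.1
  have h2 := key q.1.2 _ _ he.1.2 he'.1.2
  have h3 := key q.2.1 _ _ he.2.1 he'.2.1
  have h4 := key q.2.2 _ _ he.2.2 he'.2.2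
  simp only [Prod.fst_add, Prod.snd_add] at this
  refine this.trans ?_
  nlinarith

/-- The cube of the grid `A ℤ⁴` that contains `q`. -/
def gridDiv (A : ℕ) (q : Grid) : Grid := ((q.1.1 / A, q.1.2 / A), (q.2.1 / A, q.2.2 / A))

/-- The position of `q` in its cube of the grid `A ℤ⁴`. -/
noncomputable def gridFrac (A : ℕ) (q : Grid) : (ℝ × ℝ) × (ℝ × ℝ) :=
  ((((q.1.1 % A : ℕ) : ℝ) / A, ((q.1.2 % A : ℕ) : ℝ) / A),
    (((q.2.1 % A : ℕ) : ℝ) / A, ((q.2.2 % A : ℕ) : ℝ) / A))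

theorem gridFrac_mem (A : ℕ) (q : Grid) : gridFrac A q ∈ unitCube :=
  ⟨⟨modDiv_mem_Icc _ _, modDiv_mem_Icc _ _⟩, ⟨modDiv_mem_Icc _ _, modDiv_mem_Icc _ _⟩⟩

/-- Multilinear interpolation of `Ψ` at `q / A`. -/
noncomputable def interp (A : ℕ) (Ψ : Grid → ℝ) (q : Grid) : ℝ :=
  blend (gridFrac A q) fun e => Ψ (gridDiv A q + e)

theorem interp_eq_lerp (A : ℕ) (Ψ : Grid → ℝ) (a b c d : ℕ) :
    interp A Ψ ((a, b), (c, d)) =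
      lerp A a fun a => lerp A b fun b => lerp A c fun c => lerp A d fun d => Ψ ((a, b), (c, d)) := by
  simp only [interp, blend, corners, cornerWeight, endWeight, sum_product, sum_range_succ,
    range_zero, sum_empty, gridFrac, gridDiv, lerp]
  simp
  ring_nf

/-- Multilinear interpolation is linear interpolation in each coordinate in turn. In the direction
of the step it divides the increment by `A`; in the other directions it averages, which preserves
bounds. -/
theorem stepBounded_interp {A : ℕ} (hA : 0 < A) {K : ℝ} {Ψ : Grid → ℝ} (h : StepBounded K Ψ) :
    StepBounded (K / A) (interp A Ψ) := by
  have key : ∀ (m : ℕ) (g : ℕ → ℝ), (∀ n, |g (n + 1) - g n| ≤ K) →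
      |lerp A (m + 1) g - lerp A m g| ≤ K / A := by
    intro m g hg
    rw [lerp_succ hA, abs_div, Nat.abs_cast]
    gcongr
    exact hg _
  intro a b c d
  simp only [interp_eq_lerp]
  refine ⟨⟨?_, ?_⟩, ?_, ?_⟩
  · refine key _ _ fun a => abs_lerp_sub_lerp_le fun b => abs_lerp_sub_lerp_le fun c =>
      abs_lerp_sub_lerp_le fun d => (h a b c d).1.1
  · refine abs_lerp_sub_lerp_le fun a => key _ _ fun b => abs_lerp_sub_lerp_le fun c =>
      abs_lerp_sub_lerp_le fun d => (h a b c d).1.2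
  · refine abs_lerp_sub_lerp_le fun a => abs_lerp_sub_lerp_le fun b => key _ _ fun c =>
      abs_lerp_sub_lerp_le fun d => (h a b c d).2.1
  · refine abs_lerp_sub_lerp_le fun a => abs_lerp_sub_lerp_le fun b =>
      abs_lerp_sub_lerp_le fun c => key _ _ fun d => (h a b c d).2.2

/-! ### Greedy colouring -/

/-- Greedy colouring of a symmetric relation of bounded degree. -/
theorem exists_coloring {α : Type*} (r : α → α → Prop) (hr : ∀ x y, r x y → r y x) (D : ℕ)
    (s : Finset α) (hD : ∀ x, {y | y ∈ s ∧ r x y}.encard ≤ D) :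
    ∃ κ : α → ℕ, (∀ x, κ x < D + 1) ∧ ∀ x ∈ s, ∀ y ∈ s, x ≠ y → r x y → κ x ≠ κ y := by
  classical
  induction s using Finset.induction_on with
  | empty => exact ⟨fun _ => 0, by simp, by simp⟩
  | insert a s ha ih =>
    obtain ⟨κ, hκ, h⟩ := ih fun x => (Set.encard_le_encard
      (Set.ofPred_subset_ofPred.2 fun y hy => ⟨mem_insert_of_mem hy.1, hy.2⟩)).trans (hD x)
    have hcard : #((s.filter (r a)).image κ) < #(range (D + 1)) := by
      rw [card_range, Nat.lt_succ_iff]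
      refine card_image_le.trans ?_
      have := hD a
      rw [← Nat.cast_le (α := ℕ∞), ← Set.encard_coe_eq_coe_finsetCard]
      refine (Set.encard_le_encard fun y hy => ?_).trans this
      simp only [coe_filter, Set.mem_ofPred_eq] at hy
      exact ⟨mem_insert_of_mem hy.1, hy.2⟩
    obtain ⟨k, hk, hk'⟩ := exists_mem_notMem_of_card_lt_card hcard
    have hk2 : ∀ y ∈ s, r a y → κ y ≠ k := fun y hy hay hyk =>
      hk' (mem_image.2 ⟨y, mem_filter.2 ⟨hy, hay⟩, hyk⟩)
    refine ⟨Function.update κ a k, fun x => ?_, fun x hx y hy hxy hrxy => ?_⟩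
    · rcases eq_or_ne x a with rfl | hx
      · simpa using mem_range.1 hk
      · simpa [hx] using hκ x
    · rcases mem_insert.1 hx with rfl | hxs
      · rw [Function.update_self, Function.update_of_ne hxy.symm]
        exact (hk2 y ((mem_insert.1 hy).resolve_left hxy.symm) hrxy).symm
      · have hxa : x ≠ a := fun e => ha (e ▸ hxs)
        rcases mem_insert.1 hy with rfl | hys
        · rw [Function.update_self, Function.update_of_ne hxa]
          exact hk2 x hxs (hr _ _ hrxy)
        · have hya : y ≠ a := fun e => ha (e ▸ hys)
          rw [Function.update_of_ne hxa, Function.update_of_ne hya]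
          exact h x hxs y hys hxy hrxy

/-! ### Fibers of the coordinate sums, separation and conflicts -/

theorem mem_ringPositions {A : ℕ} {d : ℕ × ℕ} :
    d ∈ ringPositions A ↔ (d.1 < A ∧ d.2 < A) ∧
      (d.1 = 0 ∨ d.1 + 1 = A ∨ d.2 = 0 ∨ d.2 + 1 = A) := by
  simp only [ringPositions, mem_filter, mem_product, mem_range]
  refine and_congr_right fun h => ?_
  omega

/-- At most four positions of the ring lie on a given diagonal modulo `A`. -/
theorem card_ringPositions_diagonal_le {A : ℕ} (hA : 2 ≤ A) (u : ℕ) :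
    #((ringPositions A).filter fun d => (d.1 + d.2) % A = u % A) ≤ 4 := by
  -- Each side of the ring fixes one coordinate, and the congruence fixes the other. On the sides
  -- with coordinate `A - 1` it reads `t ≡ u + 1`.
  have : (ringPositions A).filter (fun d => (d.1 + d.2) % A = u % A) ⊆
      {(0, u % A), (u % A, 0), (A - 1, (u + 1) % A), ((u + 1) % A, A - 1)} := by
    rintro ⟨s, t⟩ h
    rw [mem_filter, mem_ringPositions] at h
    obtain ⟨⟨⟨hs, ht⟩, h⟩, hu⟩ := h
    simp only at hs ht h hu
    have h1 : (s + t + 1) % A = (u + 1) % A := Nat.ModEq.add_right 1 hu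
    simp only [mem_insert, mem_singleton, Prod.mk.injEq]
    rcases h with rfl | h | rfl | h
    · rw [zero_add, Nat.mod_eq_of_lt ht] at hu
      exact Or.inl ⟨rfl, hu⟩
    · have : (s + t + 1) % A = t := by
        rw [show s + t + 1 = A + t by omega, Nat.add_mod_left, Nat.mod_eq_of_lt ht]
      exact Or.inr (Or.inr (Or.inl ⟨by omega, by omega⟩))
    · rw [add_zero, Nat.mod_eq_of_lt hs] at hu
      exact Or.inr (Or.inl ⟨hu, rfl⟩)
    · have : (s + t + 1) % A = s := by
        rw [show s + t + 1 = A + s by omega, Nat.add_mod_left, Nat.mod_eq_of_lt hs]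
      exact Or.inr (Or.inr (Or.inr ⟨by omega, by omega⟩))
  exact (card_le_card this).trans card_le_four

theorem mem_carpetCells_succ {A i : ℕ} {x : ℕ × ℕ} :
    x ∈ carpetCells A (i + 1) ↔ ∃ c ∈ carpetCells A i, ∃ d ∈ ringPositions A,
      (A * c.1 + d.1, A * c.2 + d.2) = x := by
  simp only [carpetCells, mem_image, mem_product, Prod.exists]
  constructor
  · rintro ⟨a, b, c, d, ⟨h1, h2⟩, h3⟩
    exact ⟨a, b, h1, c, d, h2, h3⟩
  · rintro ⟨a, b, h1, c, d, h2, h3⟩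
    exact ⟨a, b, c, d, ⟨h1, h2⟩, h3⟩

/-- The unit `4`-cubes of `B_i × B_i` whose lower corner has given coordinate sums. -/
def fiber (A i u v : ℕ) : Finset Grid :=
  (carpetCells A i ×ˢ carpetCells A i).filter fun q => q.1.1 + q.1.2 = u ∧ q.2.1 + q.2.2 = v

theorem mem_fiber {A i u v : ℕ} {q : Grid} :
    q ∈ fiber A i u v ↔ (q.1 ∈ carpetCells A i ∧ q.2 ∈ carpetCells A i) ∧
      q.1.1 + q.1.2 = u ∧ q.2.1 + q.2.2 = v := by
  rw [fiber, mem_filter, mem_product]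

/-- In each fiber of the coordinate sums, at most `N` cubes attain nearly the same value of `Ψ`
at a given point of the cube. -/
def Separates (A i N : ℕ) (Ψ : Grid → ℝ) : Prop :=
  ∀ t ∈ unitCube, ∀ (u v : ℕ) (z : ℝ),
    #((fiber A i u v).filter fun q => |blend t (fun e => Ψ (q + e)) - z| ≤ 1 / 4) ≤ N

/-- For a fixed pair of positions `d` in the parent squares, the interpolation is a blend at the
fixed point `d / A`, and the parents run through one fiber at level `i`. This is why `Separates`
asks for all points `t` of the cube. -/
theorem Separates.card_interp_le {A i N : ℕ} (hA : 2 ≤ A) {Ψ : Grid → ℝ} (h : Separates A i N Ψ)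
    (u v : ℕ) (z : ℝ) :
    #((fiber A (i + 1) u v).filter fun q => |interp A Ψ q - z| ≤ 1 / 4) ≤ 16 * N := by
  have hA0 : 0 < A := by omega
  let T : ℕ → Finset (ℕ × ℕ) := fun u => (ringPositions A).filter fun d => (d.1 + d.2) % A = u % A
  -- The truncated subtraction and division are exact for the cubes that occur, since `u = A * (c.1
  -- + c.2) + (d.1 + d.2)`.
  let S : Grid → Finset Grid := fun d =>
    ((fiber A i ((u - (d.1.1 + d.1.2)) / A) ((v - (d.2.1 + d.2.2)) / A)).filter
      fun c => |blend (gridFrac A d) (fun e => Ψ (c + e)) - z| ≤ 1 / 4).image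
      fun c => ((A * c.1.1 + d.1.1, A * c.1.2 + d.1.2), (A * c.2.1 + d.2.1, A * c.2.2 + d.2.2))
  have hsub : (fiber A (i + 1) u v).filter (fun q => |interp A Ψ q - z| ≤ 1 / 4) ⊆
      (T u ×ˢ T v).biUnion S := by
    intro q hq
    obtain ⟨hq, hz⟩ := mem_filter.1 hq
    obtain ⟨⟨hx, hy⟩, hu, hv⟩ := mem_fiber.1 hq
    obtain ⟨x, y⟩ := q
    obtain ⟨c, hc, d, hd, rfl⟩ := mem_carpetCells_succ.1 hx
    obtain ⟨c', hc', d', hd', rfl⟩ := mem_carpetCells_succ.1 hy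
    obtain ⟨⟨l1, l2⟩, -⟩ := mem_ringPositions.1 hd
    obtain ⟨⟨l3, l4⟩, -⟩ := mem_ringPositions.1 hd'
    simp only at hu hv
    have eu : u = A * (c.1 + c.2) + (d.1 + d.2) := by rw [← hu]; ring
    have ev : v = A * (c'.1 + c'.2) + (d'.1 + d'.2) := by rw [← hv]; ring
    refine mem_biUnion.2 ⟨(d, d'), mem_product.2 ⟨mem_filter.2 ⟨hd, ?_⟩,
      mem_filter.2 ⟨hd', ?_⟩⟩, mem_image.2 ⟨(c, c'), mem_filter.2 ⟨mem_fiber.2 ⟨⟨hc, hc'⟩, ?_, ?_⟩,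
        ?_⟩, rfl⟩⟩
    · rw [eu, Nat.mul_add_mod]
    · rw [ev, Nat.mul_add_mod]
    · rw [eu, Nat.add_sub_cancel, Nat.mul_div_cancel_left _ hA0]
    · rw [ev, Nat.add_sub_cancel, Nat.mul_div_cancel_left _ hA0]
    · have hfl : ∀ a b : ℕ, b < A → (A * a + b) / A = a ∧ (A * a + b) % A = b % A := fun a b hb => by
        rw [Nat.mul_add_mod, Nat.mul_add_div hA0, Nat.div_eq_of_lt hb]
        simp
      simp only [interp, gridDiv, gridFrac] at hz
      rw [(hfl _ _ l1).1, (hfl _ _ l2).1, (hfl _ _ l3).1, (hfl _ _ l4).1, (hfl _ _ l1).2,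
        (hfl _ _ l2).2, (hfl _ _ l3).2, (hfl _ _ l4).2] at hz
      exact hz
  calc _ ≤ #((T u ×ˢ T v).biUnion S) := card_le_card hsub
    _ ≤ #(T u ×ˢ T v) * N := card_biUnion_le_card_mul _ _ _ fun d _ =>
        card_image_le.trans (h _ (gridFrac_mem A d) _ _ _)
    _ ≤ (4 * 4) * N := by
      rw [card_product]
      gcongr
      · exact card_ringPositions_diagonal_le hA u
      · exact card_ringPositions_diagonal_le hA v
    _ = 16 * N := by norm_num

/-- Two corners of cubes of `B_{i+1} × B_{i+1}` conflict when the cubes lie in the same fiber and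
the interpolation of `Ψ` does not separate them. -/
def Conflict (A i : ℕ) (Ψ : Grid → ℝ) (p p' : Grid) : Prop :=
  ∃ e ∈ corners, ∃ u v : ℕ, ∃ q ∈ fiber A (i + 1) u v, ∃ q' ∈ fiber A (i + 1) u v,
    p = q + e ∧ p' = q' + e ∧ |interp A Ψ q' - interp A Ψ q| ≤ 1 / 4

theorem Conflict.symm {A i : ℕ} {Ψ : Grid → ℝ} {p p' : Grid} (h : Conflict A i Ψ p p') :
    Conflict A i Ψ p' p := by
  obtain ⟨e, he, u, v, q, hq, q', hq', hp, hp', hd⟩ := h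
  exact ⟨e, he, u, v, q', hq', q, hq, hp', hp, by rwa [abs_sub_comm]⟩

/-- The point `p` is a corner of at most 16 cubes, and each of them has at most `16 * N` unseparated
partners in its fiber. -/
theorem Separates.encard_conflict_le {A i N : ℕ} (hA : 2 ≤ A) {Ψ : Grid → ℝ}
    (h : Separates A i N Ψ) (p : Grid) : {p' | Conflict A i Ψ p p'}.encard ≤ (256 * N : ℕ) := by
  let S : Grid → Finset Grid := fun e =>
    ((fiber A (i + 1) ((p - e).1.1 + (p - e).1.2) ((p - e).2.1 + (p - e).2.2)).filter
      fun q => |interp A Ψ q - interp A Ψ (p - e)| ≤ 1 / 4).image fun q => q + e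
  have hsub : {p' | Conflict A i Ψ p p'} ⊆ (corners.biUnion S : Finset Grid) := by
    rintro p' ⟨e, he, u, v, q, hq, q', hq', rfl, rfl, hd⟩
    have hqe : q + e - e = q := by ext <;> simp
    refine mem_coe.2 (mem_biUnion.2 ⟨e, he, mem_image.2 ⟨q', mem_filter.2 ⟨?_, ?_⟩, rfl⟩⟩)
    · rw [hqe, (mem_fiber.1 hq).2.1, (mem_fiber.1 hq).2.2]
      exact hq'
    · rwa [hqe]
  refine (Set.encard_le_encard hsub).trans ?_
  rw [Set.encard_coe_eq_coe_finsetCard, Nat.cast_le]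
  calc _ ≤ #corners * (16 * N) := card_biUnion_le_card_mul _ _ _ fun e _ =>
        card_image_le.trans (h.card_interp_le hA _ _ _)
    _ = 256 * N := by rw [card_corners]; ring

/-! ### The refinement step and the induction -/

/-- The patterns of rounded values at the corners of a cube, with a marked corner. -/
@[irreducible] noncomputable def patterns : Finset ((↥corners → ℤ) × Grid) :=
  (Fintype.piFinset fun _ => Icc (-19) 19) ×ˢ corners

theorem mem_patterns {p : (↥corners → ℤ) × Grid} :
    p ∈ patterns ↔ (∀ e, p.1 e ∈ Icc (-19) 19) ∧ p.2 ∈ corners := by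
  rw [patterns, mem_product, Fintype.mem_piFinset]

theorem patterns_nonempty : patterns.Nonempty :=
  ⟨(fun _ => 0, 0), mem_patterns.2 ⟨fun _ => by simp, by simp [corners]⟩⟩

/-- The modulus for `M` colours, which the powers of `64` represent. -/
noncomputable def colorRange (M : ℕ) : ℝ := 64 ^ M

/-- The refinement of `Ψ`: the value at `q` is close to the interpolation of `Ψ` stretched by
`A / 16`, and its remainder modulo `colorRange M` encodes the colour of `q`. -/
noncomputable def refinement (A M : ℕ) (Ψ : Grid → ℝ) (κ : Grid → ℕ) (q : Grid) : ℝ :=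
  colorRange M * ⌊A / 16 * interp A Ψ q / colorRange M⌋ + 64 ^ κ q

theorem one_le_colorRange (M : ℕ) : 1 ≤ colorRange M := by
  rw [colorRange]
  exact one_le_pow₀ (by norm_num)

theorem abs_refinement_sub_le (A : ℕ) {M : ℕ} (Ψ : Grid → ℝ) {κ : Grid → ℕ} (hκ : ∀ q, κ q < M)
    (q : Grid) : |refinement A M Ψ κ q - A / 16 * interp A Ψ q| ≤ colorRange M := by
  have h0 : 0 < colorRange M := one_pos.trans_le (one_le_colorRange M)
  have h1 : (64 : ℝ) ^ κ q ≤ colorRange M := by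
    rw [colorRange]
    exact pow_le_pow_right₀ (by norm_num) (hκ q).le
  have h2 : (0 : ℝ) < 64 ^ κ q := by positivity
  unfold refinement
  set w := (A : ℝ) / 16 * interp A Ψ q
  have h3 : colorRange M * ⌊w / colorRange M⌋ ≤ w := by
    rw [mul_comm, ← le_div_iff₀ h0]
    exact Int.floor_le _
  have h4 : w ≤ colorRange M * ⌊w / colorRange M⌋ + colorRange M := by
    have := (Int.lt_floor_add_one (w / colorRange M)).le
    rw [div_le_iff₀ h0] at this
    linarith
  rw [abs_le]
  constructor <;> linarith

/-- Write `R = colorRange M`. Interpolation turns steps `4R` into `4R / A`, stretching gives `R /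
4`, and rounding and colouring add at most `R` at each end: in total less than `4R`. -/
theorem stepBounded_refinement {A M : ℕ} (hA : 0 < A) {Ψ : Grid → ℝ}
    (h : StepBounded (4 * colorRange M) Ψ) {κ : Grid → ℕ} (hκ : ∀ q, κ q < M) :
    StepBounded (4 * colorRange M) (refinement A M Ψ κ) := by
  have hA' : (0 : ℝ) < A := by positivity
  have h0 : 0 < colorRange M := one_pos.trans_le (one_le_colorRange M)
  have key : ∀ p q : Grid, |interp A Ψ p - interp A Ψ q| ≤ 4 * colorRange M / A →
      |refinement A M Ψ κ p - refinement A M Ψ κ q| ≤ 4 * colorRange M := by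
    intro p q hpq
    have h1 := abs_le.1 (abs_refinement_sub_le A Ψ hκ p)
    have h2 := abs_le.1 (abs_refinement_sub_le A Ψ hκ q)
    have h3 : |(A : ℝ) / 16 * interp A Ψ p - A / 16 * interp A Ψ q| ≤ colorRange M / 4 := by
      rw [← mul_sub, abs_mul, abs_of_pos (by positivity)]
      calc _ ≤ (A : ℝ) / 16 * (4 * colorRange M / A) := by gcongr
        _ = colorRange M / 4 := by field_simp; norm_num
    have h4 := abs_le.1 h3
    rw [abs_le]
    constructor <;> linarith
  intro a b c d
  have H := stepBounded_interp hA h a b c d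
  exact ⟨⟨key _ _ H.1.1, key _ _ H.1.2⟩, key _ _ H.2.1, key _ _ H.2.2⟩

theorem blend_refinement {t : (ℝ × ℝ) × (ℝ × ℝ)} (A M : ℕ) (Ψ : Grid → ℝ) (κ : Grid → ℕ) (q : Grid) :
    blend t (fun e => refinement A M Ψ κ (q + e)) =
      colorRange M * blend t (fun e => (⌊A / 16 * interp A Ψ (q + e) / colorRange M⌋ : ℝ)) +
        blend t fun e => 64 ^ κ (q + e) := by
  simp only [blend, refinement, mul_add, sum_add_distrib, mul_sum]
  congr 1
  exact sum_congr rfl fun e _ => by ring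

theorem blend_congr {t : (ℝ × ℝ) × (ℝ × ℝ)} {G G' : Grid → ℝ} (h : ∀ e ∈ corners, G e = G' e) :
    blend t G = blend t G' := sum_congr rfl fun e he => by rw [h e he]

theorem exponent_le_of_pow_le {m n : ℕ} (h : (64 : ℝ) ^ m ≤ 32 * 64 ^ n) : m ≤ n := by
  by_contra! hlt
  have h1 : (64 : ℝ) ^ (n + 1) ≤ 64 ^ m := pow_le_pow_right₀ (by norm_num) hlt
  have h2 : (0 : ℝ) < 64 ^ n := by positivity
  rw [pow_succ] at h1
  linarith

/-- If the corner `e` carries a sixteenth of the interpolation of powers of `64` at `q`, and the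
interpolation at `q'` is nearly the same, then the exponents at this corner compare. -/
theorem exponent_le_of_blend {t : (ℝ × ℝ) × (ℝ × ℝ)} (ht : t ∈ unitCube) {m m' : Grid → ℕ}
    {e : Grid} (he : e ∈ corners)
    (hdom : blend t (fun e => (64 : ℝ) ^ m' e) ≤ 16 * (cornerWeight t e * 64 ^ m' e))
    (hclose : |blend t (fun e => (64 : ℝ) ^ m e) - blend t (fun e => (64 : ℝ) ^ m' e)| ≤ 1 / 2) :
    m e ≤ m' e := by
  have h1 : cornerWeight t e * 64 ^ m e ≤ blend t (fun e => (64 : ℝ) ^ m e) :=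
    le_blend (G := fun e => (64 : ℝ) ^ m e) ht (fun e _ => by positivity) he
  have h2 : 1 ≤ blend t (fun e => (64 : ℝ) ^ m' e) := by
    rw [← sum_cornerWeight t, blend]
    exact sum_le_sum fun e _ => le_mul_of_one_le_right (cornerWeight_nonneg ht e)
      (one_le_pow₀ (by norm_num))
  have h3 := (abs_le.1 hclose).2
  have hw : 0 < cornerWeight t e := by
    refine (cornerWeight_nonneg ht e).lt_of_ne fun h0 => ?_
    rw [← h0] at hdom
    linarith
  -- The second blend is at least 1, so the error `1 / 2` at most doubles it; together with the
  -- factor 16 this gives 32, below the base 64.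
  refine exponent_le_of_pow_le (le_of_mul_le_mul_left ?_ hw)
  linarith

theorem Separates.refinement {A i M N : ℕ} (hN : #patterns ≤ N) (hA : 2240 * colorRange M ≤ A)
    {Ψ : Grid → ℝ}
    (hstep : StepBounded (4 * colorRange M) Ψ) {κ : Grid → ℕ} (hκ : ∀ q, κ q < M)
    (hcol : ∀ p p', p ≠ p' → Conflict A i Ψ p p' → κ p ≠ κ p') :
    Separates A (i + 1) N (refinement A M Ψ κ) := by
  have hR : 1 ≤ colorRange M := one_le_colorRange M
  have hR0 : 0 < colorRange M := one_pos.trans_le hR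
  have hA0 : (0 : ℝ) < A := by linarith
  have hstep' := stepBounded_refinement (by exact_mod_cast hA0) hstep hκ
  intro t ht u v z
  set n : Grid → ℤ := fun p => ⌊A / 16 * interp A Ψ p / colorRange M⌋ with hn
  set n₀ : ℤ := ⌊z / colorRange M⌋ with hn₀
  have hdom : ∀ q : Grid, ∃ e ∈ corners, blend t (fun e => (64 : ℝ) ^ κ (q + e)) ≤
      16 * (cornerWeight t e * 64 ^ κ (q + e)) :=
    fun q => exists_blend_le t fun e => (64 : ℝ) ^ κ (q + e)
  choose dom dom_mem dom_le using hdom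
  -- Corners of a cube are joined by at most four steps of size `4 * colorRange M`, which accounts
  -- for 16 of the 17; the last comes from rounding.
  have near : ∀ q : Grid, |blend t (fun e => CarpetCodes.refinement A M Ψ κ (q + e)) - z| ≤ 1 / 4 →
      ∀ e ∈ corners, |A / 16 * interp A Ψ (q + e) - z| ≤ 17 * colorRange M + 1 / 4 := by
    intro q hq e he
    have h1 : |blend t (fun e => CarpetCodes.refinement A M Ψ κ (q + e)) -
        CarpetCodes.refinement A M Ψ κ (q + e)| ≤ 4 * (4 * colorRange M) :=
      abs_blend_sub_le ht fun e' he' => hstep'.abs_sub_corner_le (by positivity) q he' he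
    have h2 := abs_le.1 (abs_refinement_sub_le A Ψ hκ (q + e))
    have h3 := abs_le.1 h1
    have h4 := abs_le.1 hq
    rw [abs_le]
    constructor <;> linarith
  -- A cube is recorded by its rounded values relative to that of `z` and by its dominant corner. It
  -- remains to see that the record is a pattern and determines the cube within the fiber.
  refine (card_le_card_of_injOn (fun q => ((fun e : ↥corners => n (q + e.1) - n₀), dom q))
    (fun q hq => ?_) fun q hq q' hq' hqq' => ?_).trans hN
  · obtain ⟨hq, hz⟩ := mem_filter.1 (mem_coe.1 hq)
    refine mem_coe.2 (mem_patterns.2 ⟨fun e => mem_Icc.2 ?_, dom_mem q⟩)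
    have h1 := abs_le.1 (near q hz e.1 e.2)
    have h2 : |A / 16 * interp A Ψ (q + e.1) / colorRange M - z / colorRange M| ≤ 18 := by
      rw [← sub_div, abs_div, abs_of_pos hR0, div_le_iff₀ hR0, abs_le]
      constructor <;> linarith
    have h3 := abs_le.1 h2
    have f1 := Int.floor_le (A / 16 * interp A Ψ (q + e.1) / colorRange M)
    have f2 := Int.lt_floor_add_one (A / 16 * interp A Ψ (q + e.1) / colorRange M)
    have f3 := Int.floor_le (z / colorRange M)
    have f4 := Int.lt_floor_add_one (z / colorRange M)
    have g1 : ((-20 : ℤ) : ℝ) < ((n (q + e.1) - n₀ : ℤ) : ℝ) := by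
      push_cast
      simp only [hn, hn₀]
      linarith
    have g2 : ((n (q + e.1) - n₀ : ℤ) : ℝ) < ((20 : ℤ) : ℝ) := by
      push_cast
      simp only [hn, hn₀]
      linarith
    rw [Int.cast_lt] at g1 g2
    constructor <;> simp only <;> omega
  · obtain ⟨hq, hz⟩ := mem_filter.1 (mem_coe.1 hq)
    obtain ⟨hq', hz'⟩ := mem_filter.1 (mem_coe.1 hq')
    obtain ⟨hpat, hd⟩ := Prod.mk.inj hqq'
    have hpat' : ∀ e ∈ corners, n (q + e) = n (q' + e) := fun e he => by
      have := congrFun hpat ⟨e, he⟩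
      simpa using this
    -- The rounded parts cancel, so only the powers of 64 distinguish the two values, each within `1
    -- / 4` of `z`.
    have hclose : |blend t (fun e => (64 : ℝ) ^ κ (q + e)) -
        blend t (fun e => (64 : ℝ) ^ κ (q' + e))| ≤ 1 / 2 := by
      have e1 := blend_refinement (t := t) A M Ψ κ q
      have e2 := blend_refinement (t := t) A M Ψ κ q'
      have e3 : blend t (fun e => (n (q + e) : ℝ)) = blend t (fun e => (n (q' + e) : ℝ)) :=
        blend_congr fun e he => by rw [hpat' e he]
      simp only [hn] at e3
      rw [e3] at e1
      have h4 := abs_le.1 hz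
      have h5 := abs_le.1 hz'
      rw [abs_le]
      constructor <;> linarith
    have hle : κ (q + dom q) ≤ κ (q' + dom q) := by
      refine exponent_le_of_blend ht (m := fun e => κ (q + e)) (m' := fun e => κ (q' + e))
        (dom_mem q) ?_ hclose
      rw [hd]
      exact dom_le q'
    have hge : κ (q' + dom q) ≤ κ (q + dom q) :=
      exponent_le_of_blend ht (m := fun e => κ (q' + e)) (m' := fun e => κ (q + e))
        (dom_mem q) (dom_le q) (by rwa [abs_sub_comm])
    by_contra hne
    have hz0 : (0 : Grid) ∈ corners := by simp [corners]
    refine hcol (q + dom q) (q' + dom q) (fun h => hne (add_right_cancel h))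
      ⟨dom q, dom_mem q, u, v, q, hq, q', hq', rfl, rfl, ?_⟩ (hle.antisymm hge)
    have h1 := near q hz 0 hz0
    have h2 := near q' hz' 0 hz0
    rw [add_zero] at h1 h2
    have h3 := abs_le.1 h1
    have h4 := abs_le.1 h2
    -- By `near` the left side is at most `34 * colorRange M + 1 / 2`, hence at most `35 *
    -- colorRange M`, and `2240 = 64 * 35`.
    have h5 : |(A : ℝ) / 16 * (interp A Ψ q' - interp A Ψ q)| ≤ A / 16 * (1 / 4) := by
      rw [abs_le, mul_sub]
      constructor <;> linarith
    rw [abs_mul, abs_of_pos (by positivity)] at h5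
    exact le_of_mul_le_mul_left h5 (by positivity)

/-- There is a function on the lattice with bounded steps which separates the cubes of each fiber
of the coordinate sums. -/
theorem exists_stepBounded_separates {A M N : ℕ} (hN : #patterns ≤ N)
    (hM : 256 * N < M) (hA : 2240 * colorRange M ≤ A) (i : ℕ) :
    ∃ Ψ : Grid → ℝ, StepBounded (4 * colorRange M) Ψ ∧ Separates A i N Ψ := by
  classical
  have hR : 1 ≤ colorRange M := one_le_colorRange M
  have hA2 : 2 ≤ A := by
    have : ((2 : ℕ) : ℝ) ≤ A := by push_cast; linarith
    exact_mod_cast this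
  induction i with
  | zero =>
    -- At level 0 there is a single cube, and `N` is at least 1.
    refine ⟨fun _ => 0, fun a b c d => ?_, fun t _ u v z => ?_⟩
    · have : (0 : ℝ) ≤ 4 * colorRange M := by positivity
      simpa using this
    · calc _ ≤ #(carpetCells A 0 ×ˢ carpetCells A 0) :=
            card_le_card ((filter_subset _ _).trans (filter_subset _ _))
        _ = 1 := by simp [carpetCells]
        _ ≤ _ := patterns_nonempty.card_pos.trans_le hN
  | succ i ih =>
    obtain ⟨Ψ, hstep, hsep⟩ := ih
    let s : Finset Grid := ((carpetCells A (i + 1) ×ˢ carpetCells A (i + 1)) ×ˢ corners).image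
      fun p => p.1 + p.2
    obtain ⟨κ, hκ, hcol⟩ := exists_coloring (Conflict A i Ψ) (fun _ _ h => h.symm)
      (256 * N) s fun p => (Set.encard_le_encard
        (Set.ofPred_subset_ofPred.2 fun _ h => h.2)).trans (hsep.encard_conflict_le hA2 p)
    have hκ' : ∀ q, κ q < M := fun q => (hκ q).trans_le hM
    have hs : ∀ (u v : ℕ) (e : Grid), e ∈ corners → ∀ q ∈ fiber A (i + 1) u v, q + e ∈ s :=
      fun u v e he q hq => mem_image.2 ⟨(q, e),
        mem_product.2 ⟨mem_product.2 (mem_fiber.1 hq).1, he⟩, rfl⟩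
    refine ⟨refinement A M Ψ κ, stepBounded_refinement (by omega) hstep hκ',
      Separates.refinement hN hA hstep hκ' fun p p' hne hp => ?_⟩
    obtain ⟨e, he, u, v, q, hq, q', hq', rfl, rfl, -⟩ := id hp
    exact hcol _ (hs u v e he q hq) _ (hs u v e he q' hq') hne hp

/-! ### Lipschitz extension and the map to `ℝ³` -/

/-- The point of `ℝ⁴` with given integer coordinates. -/
noncomputable def latticePoint (q : Grid) : PlaneSq :=
  WithLp.toLp 2 (!₂[(q.1.1 : ℝ), (q.1.2 : ℝ)], !₂[(q.2.1 : ℝ), (q.2.2 : ℝ)])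

theorem abs_coord_sub_le_dist {n : ℕ} (x y : EuclideanSpace ℝ (Fin n)) (k : Fin n) :
    |x k - y k| ≤ dist x y := by
  rw [dist_eq_norm, ← Real.norm_eq_abs]
  exact PiLp.norm_apply_le (x - y) k

theorem dist_le_sum_abs {n : ℕ} (x y : EuclideanSpace ℝ (Fin n)) :
    dist x y ≤ ∑ k, |x k - y k| := by
  rw [EuclideanSpace.dist_eq]
  refine Real.sqrt_le_iff.2 ⟨sum_nonneg fun _ _ => abs_nonneg _, ?_⟩
  simp only [Real.dist_eq]
  exact sum_sq_le_sq_sum_of_nonneg fun _ _ => abs_nonneg _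

theorem dist_fst_le (x y : PlaneSq) : dist x.fst y.fst ≤ dist x y := by
  rw [WithLp.prod_dist_eq_of_L2]
  exact Real.le_sqrt_of_sq_le (by nlinarith [sq_nonneg (dist x.snd y.snd)])

theorem dist_snd_le (x y : PlaneSq) : dist x.snd y.snd ≤ dist x y := by
  rw [WithLp.prod_dist_eq_of_L2]
  exact Real.le_sqrt_of_sq_le (by nlinarith [sq_nonneg (dist x.fst y.fst)])

theorem dist_le_fst_add_snd (x y : PlaneSq) :
    dist x y ≤ dist x.fst y.fst + dist x.snd y.snd := by
  rw [WithLp.prod_dist_eq_of_L2]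
  exact Real.sqrt_le_iff.2 ⟨by positivity, by
    nlinarith [mul_nonneg (dist_nonneg (x := x.fst) (y := y.fst))
      (dist_nonneg (x := x.snd) (y := y.snd))]⟩

/-- A function on the lattice with bounded steps extends to a Lipschitz function on `ℝ⁴`. -/
theorem StepBounded.exists_lipschitz_extension {K : ℝ} {Ψ : Grid → ℝ} (hK : 0 ≤ K)
    (h : StepBounded K Ψ) : ∃ g : PlaneSq → ℝ,
      (∀ x y, |g x - g y| ≤ 4 * K * dist x y) ∧ ∀ q, g (latticePoint q) = Ψ q := by
  have key : ∀ p q : Grid, |Ψ p - Ψ q| ≤ 4 * K * dist (latticePoint p) (latticePoint q) := by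
    intro p q
    have h1 := dist_fst_le (latticePoint p) (latticePoint q)
    have h2 := dist_snd_le (latticePoint p) (latticePoint q)
    have a := abs_coord_sub_le_dist (latticePoint p).fst (latticePoint q).fst 0
    have b := abs_coord_sub_le_dist (latticePoint p).fst (latticePoint q).fst 1
    have c := abs_coord_sub_le_dist (latticePoint p).snd (latticePoint q).snd 0
    have d := abs_coord_sub_le_dist (latticePoint p).snd (latticePoint q).snd 1
    generalize dist (latticePoint p) (latticePoint q) = D at *
    generalize dist (latticePoint p).fst (latticePoint q).fst = D₁ at *
    generalize dist (latticePoint p).snd (latticePoint q).snd = D₂ at *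
    change |(p.1.1 : ℝ) - q.1.1| ≤ D₁ at a
    change |(p.1.2 : ℝ) - q.1.2| ≤ D₁ at b
    change |(p.2.1 : ℝ) - q.2.1| ≤ D₂ at c
    change |(p.2.2 : ℝ) - q.2.2| ≤ D₂ at d
    refine (h.abs_sub_le_l1 p q).trans ?_
    nlinarith
  -- The Lipschitz bound at distance zero makes `Ψ` well defined on the set of lattice points,
  -- whichever preimage `σ` picks.
  have hinj : ∀ p q : Grid, latticePoint p = latticePoint q → Ψ p = Ψ q := by
    intro p q hpq
    have := key p q
    rw [hpq, dist_self, mul_zero] at this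
    exact sub_eq_zero.1 (abs_nonpos_iff.1 this)
  choose! σ hσ using fun (x : PlaneSq) (hx : x ∈ Set.range latticePoint) => hx
  have hlip : LipschitzOnWith (4 * K).toNNReal (fun x => Ψ (σ x)) (Set.range latticePoint) := by
    refine LipschitzOnWith.of_dist_le_mul fun x hx y hy => ?_
    have := key (σ x) (σ y)
    rw [hσ x hx, hσ y hy] at this
    rwa [Real.dist_eq, Real.coe_toNNReal _ (by positivity)]
  obtain ⟨g, hg, heq⟩ := hlip.extend_real
  refine ⟨g, fun x y => ?_, fun q => ?_⟩
  · have := hg.dist_le_mul x y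
    rwa [Real.dist_eq, Real.coe_toNNReal _ (by positivity)] at this
  · rw [← heq (Set.mem_range_self q)]
    exact hinj _ _ (hσ _ (Set.mem_range_self q))

/-- The map to `ℝ³` given by the coordinate sums and a third coordinate. -/
noncomputable def spaceMap (g : PlaneSq → ℝ) (x : PlaneSq) : Space :=
  !₂[x.fst 0 + x.fst 1, x.snd 0 + x.snd 1, g x]

theorem dist_spaceMap_le {g : PlaneSq → ℝ} {L : ℝ}
    (hg : ∀ x y, |g x - g y| ≤ L * dist x y) (x y : PlaneSq) :
    dist (spaceMap g x) (spaceMap g y) ≤ (4 + L) * dist x y := by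
  refine (dist_le_sum_abs _ _).trans ?_
  have h1 := dist_fst_le x y
  have h2 := dist_snd_le x y
  have a := abs_coord_sub_le_dist x.fst y.fst 0
  have b := abs_coord_sub_le_dist x.fst y.fst 1
  have c := abs_coord_sub_le_dist x.snd y.snd 0
  have d := abs_coord_sub_le_dist x.snd y.snd 1
  have e := hg x y
  have f1 : |x.fst 0 + x.fst 1 - (y.fst 0 + y.fst 1)| ≤ |x.fst 0 - y.fst 0| + |x.fst 1 - y.fst 1| := by
    rw [add_sub_add_comm]
    exact abs_add_le _ _
  have f2 : |x.snd 0 + x.snd 1 - (y.snd 0 + y.snd 1)| ≤ |x.snd 0 - y.snd 0| + |x.snd 1 - y.snd 1| := by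
    rw [add_sub_add_comm]
    exact abs_add_le _ _
  simp only [spaceMap, Fin.sum_univ_three, PiLp.toLp_apply, Matrix.cons_val_zero,
    Matrix.cons_val_one, Matrix.cons_val]
  linarith

theorem latticePoint_mem_cube (q : Grid) : latticePoint q ∈ cube q := by
  simp [cube, square, latticePoint]

theorem dist_le_two_of_mem_square {c : ℕ × ℕ} {x y : Plane} (hx : x ∈ square 1 c)
    (hy : y ∈ square 1 c) : dist x y ≤ 2 := by
  simp only [square, one_mul, Set.mem_ofPred_eq] at hx hy
  refine (dist_le_sum_abs x y).trans ?_
  rw [Fin.sum_univ_two]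
  have h0 : |x 0 - y 0| ≤ 1 := abs_le.2 ⟨by linarith, by linarith⟩
  have h1 : |x 1 - y 1| ≤ 1 := abs_le.2 ⟨by linarith, by linarith⟩
  linarith

theorem dist_le_four_of_mem_cube {q : Grid} {x y : PlaneSq} (hx : x ∈ cube q) (hy : y ∈ cube q) :
    dist x y ≤ 4 := by
  have := dist_le_fst_add_snd x y
  have := dist_le_two_of_mem_square hx.1 hy.1
  have := dist_le_two_of_mem_square hx.2 hy.2
  linarith

theorem card_Icc_floor_le (z ρ : ℝ) (hρ : 0 ≤ ρ) :
    #(Icc ⌊z - ρ⌋ ⌊z + ρ⌋) ≤ ⌈2 * ρ + 2⌉₊ := by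
  have h1 := Int.floor_le (z + ρ)
  have h2 := Int.lt_floor_add_one (z - ρ)
  have h3 : ⌊z - ρ⌋ ≤ ⌊z + ρ⌋ := Int.floor_le_floor (by linarith)
  rw [Int.card_Icc, Int.toNat_le, ← Int.cast_le (R := ℝ)]
  push_cast
  have h4 := Nat.le_ceil (2 * ρ + 2)
  linarith

theorem floor_mem_Icc {x z ρ : ℝ} (h : |x - z| ≤ ρ) : ⌊x⌋ ∈ Icc ⌊z - ρ⌋ ⌊z + ρ⌋ := by
  have := abs_le.1 h
  exact mem_Icc.2 ⟨Int.floor_le_floor (by linarith), Int.floor_le_floor (by linarith)⟩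

theorem zero_mem_unitCube : 0 ∈ unitCube := by
  have h : (0 : ℝ) ∈ Set.Icc (0 : ℝ) 1 := ⟨le_rfl, zero_le_one⟩
  exact ⟨⟨h, h⟩, h, h⟩

theorem blend_zero (G : Grid → ℝ) : blend 0 G = G 0 := by
  simp [blend, corners, cornerWeight, endWeight, sum_product]
  rfl

/-- The box is cut into cells by the integer parts of the two sums and of `2 * Ψ q`. A cell lies in
one fiber and in a value interval of length `1 / 2`, so it contains at most `N` cubes by separation
at the lower corner `t = 0`. -/
theorem Separates.card_le {A i N : ℕ} {Ψ : Grid → ℝ} (h : Separates A i N Ψ) {ρ : ℝ} (hρ : 0 ≤ ρ)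
    (z₀ z₁ z₂ : ℝ) :
    #((carpetCells A i ×ˢ carpetCells A i).filter fun q => |(q.1.1 + q.1.2 : ℝ) - z₀| ≤ ρ ∧
      |(q.2.1 + q.2.2 : ℝ) - z₁| ≤ ρ ∧ |Ψ q - z₂| ≤ ρ) ≤
      N * (⌈2 * ρ + 2⌉₊ * (⌈2 * ρ + 2⌉₊ * ⌈2 * (2 * ρ) + 2⌉₊)) := by
  classical
  let φ : Grid → ℤ × ℤ × ℤ := fun q =>
    (⌊(q.1.1 + q.1.2 : ℝ)⌋, ⌊(q.2.1 + q.2.2 : ℝ)⌋, ⌊2 * Ψ q⌋)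
  let T : Finset (ℤ × ℤ × ℤ) := Icc ⌊z₀ - ρ⌋ ⌊z₀ + ρ⌋ ×ˢ
    (Icc ⌊z₁ - ρ⌋ ⌊z₁ + ρ⌋ ×ˢ Icc ⌊2 * z₂ - 2 * ρ⌋ ⌊2 * z₂ + 2 * ρ⌋)
  refine (card_le_mul_card_image_of_maps_to (f := φ) (t := T) (fun q hq => ?_) N
    fun b _ => ?_).trans ?_
  · obtain ⟨-, h0, h1, h2⟩ := mem_filter.1 hq
    refine mem_product.2 ⟨floor_mem_Icc h0, mem_product.2 ⟨floor_mem_Icc h1, floor_mem_Icc ?_⟩⟩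
    rw [← mul_sub, abs_mul, abs_two]
    linarith
  -- The value `b.2.2 / 2 + 1 / 4` is the midpoint of the cell.
  · refine (card_le_card fun q hq => ?_).trans
      (h 0 zero_mem_unitCube b.1.toNat b.2.1.toNat ((b.2.2 : ℝ) / 2 + 1 / 4))
    obtain ⟨hq', rfl⟩ := mem_filter.1 hq
    obtain ⟨hc, -, -, -⟩ := mem_filter.1 hq'
    refine mem_filter.2 ⟨mem_fiber.2 ⟨mem_product.1 hc, ?_, ?_⟩, ?_⟩
    · simp only [φ]
      rw [← Nat.cast_add, Int.floor_natCast, Int.toNat_natCast]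
    · simp only [φ]
      rw [← Nat.cast_add, Int.floor_natCast, Int.toNat_natCast]
    · rw [blend_zero, add_zero]
      have h1 := Int.floor_le (2 * Ψ q)
      have h2 := Int.lt_floor_add_one (2 * Ψ q)
      simp only [φ]
      rw [abs_le]
      constructor <;> linarith
  · simp only [T, card_product]
    gcongr <;> exact card_Icc_floor_le _ _ (by positivity)

theorem exists_isLocalRegionEmbedding {A M N : ℕ} (hN : #patterns ≤ N) (hM : 256 * N < M)
    (hA : 2240 * colorRange M ≤ A) :
    ∃ (K : ℝ) (N' : ℕ), ∀ i : ℕ, ∃ f : PlaneSq → Space, IsLocalRegionEmbedding A i K N' f := by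
  classical
  have hR : 0 < colorRange M := one_pos.trans_le (one_le_colorRange M)
  set L : ℝ := 4 + 4 * (4 * colorRange M) with hL
  set ρ : ℝ := 1 + L * 4 with hρ
  refine ⟨L, N * (⌈2 * ρ + 2⌉₊ * (⌈2 * ρ + 2⌉₊ * ⌈2 * (2 * ρ) + 2⌉₊)), fun i => ?_⟩
  obtain ⟨Ψ, hstep, hsep⟩ := exists_stepBounded_separates hN hM hA i
  obtain ⟨g, hg, hgΨ⟩ := hstep.exists_lipschitz_extension (by positivity)
  refine ⟨spaceMap g, fun x _ y _ => dist_spaceMap_le hg x y, fun z => ?_⟩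
  refine le_trans ?_ (Nat.cast_le.2 (hsep.card_le (show 0 ≤ ρ by positivity) (z 0) (z 1) (z 2)))
  rw [← Set.encard_coe_eq_coe_finsetCard]
  refine Set.encard_le_encard ?_
  rintro q ⟨hq, _, ⟨x, hx, rfl⟩, hz⟩
  -- If the image of a cube meets the ball, then the image of its lower corner is within `1 + L * 4`
  -- of the centre, since the cube has diameter at most 4.
  have h1 : dist (spaceMap g (latticePoint q)) z ≤ ρ := by
    have h2 := dist_triangle (spaceMap g (latticePoint q)) (spaceMap g x) z
    have h3 := dist_spaceMap_le hg (latticePoint q) x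
    have h4 : L * dist (latticePoint q) x ≤ L * 4 := by
      gcongr
      exact dist_le_four_of_mem_cube (latticePoint_mem_cube q) hx
    have h5 := Metric.mem_closedBall.1 hz
    linarith
  refine mem_coe.2 (mem_filter.2 ⟨hq, ?_, ?_, ?_⟩)
  · exact (abs_coord_sub_le_dist (spaceMap g (latticePoint q)) z 0).trans h1
  · exact (abs_coord_sub_le_dist (spaceMap g (latticePoint q)) z 1).trans h1
  · rw [← hgΨ]
    exact (abs_coord_sub_le_dist (spaceMap g (latticePoint q)) z 2).trans h1

/-! ### Hypergraph products of local codes -/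

theorem square_subset_closedBall (c : ℕ × ℕ) :
    square 1 c ⊆ Metric.closedBall !₂[(c.1 : ℝ) + 1 / 2, (c.2 : ℝ) + 1 / 2] 1 := by
  intro x hx
  simp only [square, one_mul, Set.mem_ofPred_eq] at hx
  refine Metric.mem_closedBall.2 ((dist_le_sum_abs _ _).trans ?_)
  rw [Fin.sum_univ_two]
  have h0 : |x 0 - (c.1 + 1 / 2)| ≤ 1 / 2 := abs_le.2 ⟨by linarith, by linarith⟩
  have h1 : |x 1 - (c.2 + 1 / 2)| ≤ 1 / 2 := abs_le.2 ⟨by linarith, by linarith⟩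
  simp only [Matrix.cons_val_zero, Matrix.cons_val_one]
  linarith

/-- The qubits and checks of a hypergraph product as pairs of bits or checks. -/
def factors {n₁ n₁' n₂ n₂' : ℕ} :
    ((Fin n₁ × Fin n₂') ⊕ (Fin n₁' × Fin n₂)) ⊕ ((Fin n₁ × Fin n₂) ⊕ (Fin n₁' × Fin n₂')) →
      (Fin n₁ ⊕ Fin n₁') × (Fin n₂ ⊕ Fin n₂')
  | Sum.inl (Sum.inl p) => (Sum.inl p.1, Sum.inr p.2)
  | Sum.inl (Sum.inr p) => (Sum.inr p.1, Sum.inl p.2)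
  | Sum.inr (Sum.inl p) => (Sum.inl p.1, Sum.inl p.2)
  | Sum.inr (Sum.inr p) => (Sum.inr p.1, Sum.inr p.2)

theorem factors_injective {n₁ n₁' n₂ n₂' : ℕ} :
    Function.Injective (factors : _ → (Fin n₁ ⊕ Fin n₁') × (Fin n₂ ⊕ Fin n₂')) := by
  rintro ((⟨a, b⟩ | ⟨a, b⟩) | (⟨a, b⟩ | ⟨a, b⟩)) ((⟨c, d⟩ | ⟨c, d⟩) | (⟨c, d⟩ | ⟨c, d⟩)) h <;>
    simp_all [factors]

/-- Hypergraph products of codes that are local on `B_i` are local in any map of `B_i × B_i` with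
bounded distances and bounded density. -/
theorem IsLocalRegionEmbedding.hypergraphProduct_isLocal {A i N : ℕ} {K : ℝ}
    {f : PlaneSq → Space} (hA : A ≠ 0) (hf : IsLocalRegionEmbedding A i K N f) {F : Type*} [Field F]
    {n₁ n₁' n₂ n₂' : ℕ} {H₁ : Matrix (Fin n₁') (Fin n₁) F} {H₂ : Matrix (Fin n₂') (Fin n₂) F}
    {r : ℝ} {ρ : ℕ} (h₁ : HasLocalEmbedding H₁ (scaledPrefractal A i) r ρ)
    (h₂ : HasLocalEmbedding H₂ (scaledPrefractal A i) r ρ) :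
    (hypergraphProduct H₁ H₂).IsLocal 3 (max K 0 * r) (N * (ρ * ρ)) := by
  classical
  obtain ⟨I₁, mem₁, dist₁, dens₁⟩ := h₁
  obtain ⟨I₂, mem₂, dist₂, dens₂⟩ := h₂
  let J : (Fin n₁ ⊕ Fin n₁') × (Fin n₂ ⊕ Fin n₂') → PlaneSq := fun p =>
    WithLp.toLp 2 (I₁ p.1, I₂ p.2)
  have hJ : ∀ p, J p ∈ prefractalSq A i := fun p => ⟨mem₁ _, mem₂ _⟩
  -- Nothing forces `K` to be nonnegative, hence `max K 0`.
  have hdist : ∀ p p', dist (I₁ p.1) (I₁ p'.1) + dist (I₂ p.2) (I₂ p'.2) ≤ r →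
      dist (f (J p)) (f (J p')) ≤ max K 0 * r := fun p p' h =>
    calc _ ≤ K * dist (J p) (J p') := hf.dist_le _ (hJ p) _ (hJ p')
      _ ≤ max K 0 * r := mul_le_mul (le_max_left _ _)
        ((dist_le_fst_add_snd _ _).trans h) dist_nonneg (le_max_right _ _)
  refine ⟨fun s => f (J (factors s)), fun _ => trivial, fun k b hkb => ?_, fun z => ?_⟩
  · refine hdist _ _ ?_
    -- A nonzero entry of a Kronecker product with an identity matrix forces one factor to agree and
    -- the other pair to interact in its classical code.
    rcases k with ⟨a, b'⟩ | ⟨a, b'⟩ <;> rcases b with ⟨c, d⟩ | ⟨c, d⟩ <;>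
      simp [CSSCode.checks, hypergraphProduct, Matrix.one_apply] at hkb <;>
      simp only [factors]
    · rw [hkb.1, dist_self, zero_add, dist_comm]
      exact dist₂ _ _ hkb.2
    · rw [hkb.1, dist_self, add_zero, dist_comm]
      exact dist₁ _ _ hkb.2
    · rw [hkb.1, dist_self, add_zero]
      exact dist₁ _ _ hkb.2
    · rw [hkb.1, dist_self, zero_add]
      exact dist₂ _ _ hkb.2
  · let C : Finset Grid := (carpetCells A i ×ˢ carpetCells A i).filter
      fun c => (f '' cube c ∩ Metric.closedBall z 1).Nonempty
    have hC : #C ≤ N := by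
      have := hf.density_le z
      rw [← Nat.cast_le (α := ℕ∞), ← Set.encard_coe_eq_coe_finsetCard, coe_filter]
      exact this
    let S₁ : ℕ × ℕ → Finset (Fin n₁ ⊕ Fin n₁') := fun c => univ.filter fun s => I₁ s ∈ square 1 c
    let S₂ : ℕ × ℕ → Finset (Fin n₂ ⊕ Fin n₂') := fun c => univ.filter fun s => I₂ s ∈ square 1 c
    have hS₁ : ∀ c, #(S₁ c) ≤ ρ := fun c => by
      rw [← Nat.cast_le (α := ℕ∞), ← Set.encard_coe_eq_coe_finsetCard, coe_filter]
      refine (Set.encard_le_encard fun s hs => ?_).trans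
        (dens₁ !₂[(c.1 : ℝ) + 1 / 2, (c.2 : ℝ) + 1 / 2])
      exact square_subset_closedBall c (And.right hs)
    have hS₂ : ∀ c, #(S₂ c) ≤ ρ := fun c => by
      rw [← Nat.cast_le (α := ℕ∞), ← Set.encard_coe_eq_coe_finsetCard, coe_filter]
      refine (Set.encard_le_encard fun s hs => ?_).trans
        (dens₂ !₂[(c.1 : ℝ) + 1 / 2, (c.2 : ℝ) + 1 / 2])
      exact square_subset_closedBall c (And.right hs)
    -- Every pair placed in the ball lies in one of the at most `N` cubes whose image meets it, and
    -- each cube holds at most `ρ * ρ` pairs.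
    have hmaps : Set.MapsTo factors {s | f (J (factors s)) ∈ Metric.closedBall z 1}
        ((C.biUnion fun c => S₁ c.1 ×ˢ S₂ c.2 : Finset _) :
          Set ((Fin n₁ ⊕ Fin n₁') × (Fin n₂ ⊕ Fin n₂'))) := by
      intro s hs
      rw [Set.mem_ofPred_eq] at hs
      generalize factors s = p at hs ⊢
      have m₁ := mem₁ p.1
      have m₂ := mem₂ p.2
      rw [scaledPrefractal_eq A i hA] at m₁ m₂
      simp only [Set.mem_iUnion] at m₁ m₂
      obtain ⟨c₁, hc₁, hx₁⟩ := m₁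
      obtain ⟨c₂, hc₂, hx₂⟩ := m₂
      refine mem_coe.2 (mem_biUnion.2 ⟨(c₁, c₂), mem_filter.2 ⟨mem_product.2 ⟨hc₁, hc₂⟩, ?_⟩,
        mem_product.2 ⟨mem_filter.2 ⟨mem_univ _, hx₁⟩, mem_filter.2 ⟨mem_univ _, hx₂⟩⟩⟩)
      exact ⟨f (J p), ⟨J p, ⟨hx₁, hx₂⟩, rfl⟩, hs⟩
    refine (Set.encard_le_encard_of_injOn hmaps factors_injective.injOn).trans ?_
    rw [Set.encard_coe_eq_coe_finsetCard, Nat.cast_le]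
    refine (card_biUnion_le_card_mul _ _ (ρ * ρ) fun c _ => ?_).trans (by gcongr)
    rw [card_product]
    exact Nat.mul_le_mul (hS₁ _) (hS₂ _)

end CarpetCodes

theorem mainTheorem2 :
    ∃ A₀ : ℕ, ∀ A : ℕ, A₀ ≤ A →
      (∃ (K : ℝ) (N : ℕ), ∀ i : ℕ, ∃ f : CarpetCodes.PlaneSq → CarpetCodes.Space,
        CarpetCodes.IsLocalRegionEmbedding A i K N f) ∧
      (∀ (r : ℝ) (ρ : ℕ), ∃ (r' : ℝ) (ρ' : ℕ),
        ∀ (i : ℕ) (F : Type*) [Field F] (n₁ n₁' n₂ n₂' : ℕ)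
          (H₁ : Matrix (Fin n₁') (Fin n₁) F) (H₂ : Matrix (Fin n₂') (Fin n₂) F),
          CarpetCodes.HasLocalEmbedding H₁ (CarpetCodes.scaledPrefractal A i) r ρ →
          CarpetCodes.HasLocalEmbedding H₂ (CarpetCodes.scaledPrefractal A i) r ρ →
          (CarpetCodes.hypergraphProduct H₁ H₂).IsLocal 3 r' ρ') := by
  -- The choice is not circular: the number of patterns depends on neither `M` nor `A`, and `M` does
  -- not depend on `A`.
  obtain ⟨N, hN⟩ : ∃ N, CarpetCodes.patterns.card ≤ N := ⟨_, le_rfl⟩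
  obtain ⟨M, hM⟩ : ∃ M, 256 * N < M := exists_gt _
  obtain ⟨A₀, hA₀⟩ := exists_nat_ge (2240 * CarpetCodes.colorRange M)
  refine ⟨A₀, fun A hA => ?_⟩
  have hA' : 2240 * CarpetCodes.colorRange M ≤ A := hA₀.trans (Nat.cast_le.2 hA)
  obtain ⟨K, N', h⟩ := CarpetCodes.exists_isLocalRegionEmbedding hN hM hA'
  refine ⟨⟨K, N', h⟩, fun r ρ => ⟨max K 0 * r, N' * (ρ * ρ), ?_⟩⟩
  intro i F _ n₁ n₁' n₂ n₂' H₁ H₂ h₁ h₂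
  have hA0 : A ≠ 0 := by
    rintro rfl
    have := CarpetCodes.one_le_colorRange M
    rw [Nat.cast_zero] at hA'
    linarith
  obtain ⟨f, hf⟩ := h i
  exact hf.hypergraphProduct_isLocal hA0 h₁ h₂
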